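/- **Machine and programs.** A program $P$ is a finite list of instructions over finitely many registers with integer constants (its inputs are compiled in): $\mathbf{addi}\ x\,y\,k$ ($x\leftarrow y+k$), $\mathbf{blt}\ x\,y\,k\,L$ (if $x<y+k$ goto $L$) and $\mathbf{b}\ L$ (goto $L$). On the $n$-bit platform all arithmetic is modulo $2^n$, registers start at $0$, and $x<y+k$ is decided by the sign bit of the $n$-bit word $x-(y+k)$. The runtime trace lists, for each step, the program counter, the instruction executed with its constant, and the word written, if any. **Unrolling.** An unrolling $P_n$ of $P$ for the $n$-bit platform starts with the additions that $P$ executes, as straight-line code, either until $P$ ends (complete unrolling) or for at least $2^n$ instructions, after which it jumps into a copy of $P$ with its loops and branches and with trailer instructions $r\leftarrow r+0$. So there are no loops or branches in the first $2^n$ instructions. **Chaotic compilation.** A compilation of $P_n$ chooses, for each point of the code and each register, an offset in $\mathbb Z/2^n$ of the content from its nominal value, such that all offsets are $0$ at the start and passing an instruction changes at most the offset of the register it writes. The embedded constants are adjusted accordingly: with offsets $d$ before and $d'$ after it, $\mathbf{addi}\ x\,y\,k$ gets the constant $k-d_y+d'_x$ and $\mathbf{blt}\ x\,y\,k\,L$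 gets $k-d_y+d_x$. Maximal-entropy chaotic compilation draws such a choice uniformly at random. The intended value of a bit of a word written in the trace is its value in the run without offsets. **Observers.** A polynomial-time method $f$ guessing $m$ bits is a probabilistic Turing machine with a read-only input tape that holds $n$ in unary followed by the encoded trace (read from its beginning), which on every such input halts within $\tau(n)$ steps, $\tau$ a polynomial. It is not told the program. **Statement.** Let $P$ be a program and, for all large $n$, $P_n$ an unrolling of $P$ for the $n$-bit platform. Choose bits $(M_1,i_1),\dots,(M_m,i_m)$, $m\ge 1$, of the trace (bit $i_l$ of the word written in step $M_l$, counting from $0$), where each instruction $M_l$ exists in $P_n$ for all large $n$. Then for each $j\in\{1,\dots,m\}$ there are a program $Q$ and codes $Q_n$, independent of $f$, such that for all large $n$: 1. $Q_n$ is an unrolling of $Q$, and its first $2^n$ instructions (all of them, if there are fewer) are those of $P_n$ with the constant $k$ of instruction $M_j$ changed to $k+2^{i_j}$ (that is, to $k+1$ for the least significant bit) and with $2^{i_j}$ subtracted from the constant of each later instruction that reads the result before it is written over; 2. under maximal-entropy chaotic compilation, the first $2^n$ steps of the traces of $P_n$ and of $Q_n$ have the same distribution; 3. the intended value of bit $(M_j,i_j)$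 in $Q_n$ is the opposite of that in $P_n$. Moreover, for every polynomial-time method $f$ guessing $m$ bits: 4. for all large $n$, if $f$ guesses bit $(M_j,i_j)$ right with probability $p_n$ from the trace of the compiled $P_n$, then it guesses it right with probability exactly $1-p_n$ from the trace of the compiled $Q_n$ (so it does no better than chance, $1/2$, between the two possible intentions); 5. there is no $B>1/2$ such that, for infinitely many $n$, $f$ guesses all $m$ chosen bits right with probability at least $B$ both for $P_n$ and for $Q_n$. In particular, no polynomial-time method predicts a chosen bit correctly, for all programs, with probability at least some $B>1/2$ for all large $n$. -/

import Mathlib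

namespace Chaotic

/-! ## Machine code -/

/-- Machine instructions over registers `Fin R` with embedded constants of type `K`:
`addi x y k` is `x ← y + k`; `blt x y k L` is `if x < y + k goto L`; `b L` is `goto L`. -/
inductive Instr (R : ℕ) (K : Type) where
  | addi (x y : Fin R) (k : K)
  | blt (x y : Fin R) (k : K) (L : ℕ)
  | b (L : ℕ)

namespace Instr

variable {R : ℕ} {K K' : Type}

/-- Apply `f` to the embedded constant. -/
def mapConst (f : K → K') : Instr R K → Instr R K'
  | addi x y k => addi x y (f k)
  | blt x y k L => blt x y (f k) L
  | b L => b L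

/-- Apply `g` to the branch target, if there is one. -/
def mapTarget (g : ℕ → ℕ) : Instr R K → Instr R K
  | addi x y k => addi x y k
  | blt x y k L => blt x y k (g L)
  | b L => b (g L)

def isAddi : Instr R K → Bool
  | addi _ _ _ => true
  | _ => false

/-- The register written, if any. -/
def written : Instr R K → Option (Fin R)
  | addi x _ _ => some x
  | _ => none

/-- The addresses that control may pass to after the instruction at address `pc`. -/
def successors (pc : ℕ) : Instr R K → List ℕ
  | addi _ _ _ => [pc + 1]
  | blt _ _ _ L => [pc + 1, L]
  | b L => [L]

end Instr

/-- A program as its author writes it: a list of instructions with integer constants (its inputs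
are compiled in). Execution starts at address `0`; it ends when control leaves the list. -/
abbrev Program (R : ℕ) := List (Instr R ℤ)

/-- Machine code for a platform with `n`-bit words. -/
abbrev Code (R n : ℕ) := List (Instr R (BitVec n))

/-- The program read as `n`-bit machine code. The constants are reduced modulo `2 ^ n`, which is
exact for all large `n`. -/
def Program.onPlatform {R : ℕ} (P : Program R) (n : ℕ) : Code R n :=
  P.map (Instr.mapConst (BitVec.ofInt n))

structure State (R n : ℕ) where
  pc : ℕ
  reg : Fin R → BitVec n

/-- One line of a runtime trace: the program counter, the instruction executed with its embedded
constant, and the word written, if any. -/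
structure Entry (R n : ℕ) where
  pc : ℕ
  instr : Instr R (BitVec n)
  value : Option (BitVec n)

/-- One machine step; `none` when the program counter is outside the code.
The test `x < y + k` is decided by the sign bit of the `n`-bit difference `x - (y + k)`. -/
def step {R n : ℕ} (p : Code R n) (s : State R n) : Option (Entry R n × State R n) :=
  match p[s.pc]? with
  | none => none
  | some (.addi x y k) =>
      some (⟨s.pc, .addi x y k, some (s.reg y + k)⟩,
        ⟨s.pc + 1, Function.update s.reg x (s.reg y + k)⟩)
  | some (.blt x y k L) =>
      some (⟨s.pc, .blt x y k L, none⟩,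
        ⟨if (s.reg x - (s.reg y + k)).msb then L else s.pc + 1, s.reg⟩)
  | some (.b L) => some (⟨s.pc, .b L, none⟩, ⟨L, s.reg⟩)

/-- The machine state after `t` steps from the all-zero state; a halted machine stays put. -/
def stateAt {R n : ℕ} (p : Code R n) : ℕ → State R n
  | 0 => ⟨0, fun _ => 0⟩
  | t + 1 =>
    match step p (stateAt p t) with
    | none => stateAt p t
    | some (_, s) => s

/-- The runtime trace: line `t` is `none` if the machine has halted by then. -/
def trace {R n : ℕ} (p : Code R n) (t : ℕ) : Option (Entry R n) :=
  (step p (stateAt p t)).map Prod.fst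

/-- The add instructions executed during the first `t` steps, in order of execution. -/
def executedAdds {R n : ℕ} (p : Code R n) (t : ℕ) : Code R n :=
  (((List.range t).filterMap (trace p)).map Entry.instr).filter Instr.isAddi

/-! ## Unrolling -/

/-- Instructions `r ← r + 0`, one per register. They do nothing by themselves; they are the places
where the compiler can bring the registers back to prescribed offsets. -/
def trailers (R n : ℕ) : Code R n :=
  (List.finRange R).map fun r => .addi r r 0

/-- An instruction with trailers: after an addition, before a branch. -/
def block {R n : ℕ} : Instr R (BitVec n) → Code R n
  | .addi x y k => .addi x y k :: trailers R n
  | .blt x y k L => trailers R n ++ [.blt x y k L]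
  | .b L => trailers R n ++ [.b L]

/-- The code `p` with trailers, loops and branches retained, located from address `base` on.
Each instruction becomes a block of `R + 1` instructions. -/
def loopCode {R n : ℕ} (base : ℕ) (p : Code R n) : Code R n :=
  p.flatMap fun c => block (c.mapTarget fun L => base + (R + 1) * L)

/-- `q` is an unrolling of the program `P` for the `n`-bit platform: it starts with the additions
that `P` executes in its first `t` steps, as straight-line code, and either `P` has ended by then
(complete unrolling), or at least `2 ^ n` instructions have been unrolled, and `q` goes on with the
rest of the execution of `P` by a jump into a copy of `P`. -/
def IsUnrolling {R : ℕ} (n : ℕ) (P : Program R) (q : Code R n) : Prop :=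
  ∃ t : ℕ,
    (trace (P.onPlatform n) t = none ∧ q = executedAdds (P.onPlatform n) t) ∨
    (2 ^ n ≤ (executedAdds (P.onPlatform n) t).length ∧
      ∃ base : ℕ, base = (executedAdds (P.onPlatform n) t).length + 1 ∧
        q = executedAdds (P.onPlatform n) t ++
          .b (base + (R + 1) * (stateAt (P.onPlatform n) t).pc) ::
            loopCode base (P.onPlatform n))

/-! ## Chaotic compilation -/

/-- A choice, for each address of the code `p` and for the exit point `p.length`, of the offset of
the content of each register from its nominal value just before control passes that point. -/
abbrev Offsets {R n : ℕ} (p : Code R n) := Fin (p.length + 1) → Fin R → BitVec n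

/-- The offsets in force at address `a`; all addresses outside the code are the exit point. -/
def Offsets.at {R n : ℕ} {p : Code R n} (δ : Offsets p) (a : ℕ) : Fin R → BitVec n :=
  δ ⟨min a p.length, Nat.lt_succ_of_le (Nat.min_le_right _ _)⟩

/-- The offsets that a compiler may choose: execution starts with no offsets, and passing from
one instruction to a possible next one changes at most the offset of the register written. -/
def Admissible {R n : ℕ} (p : Code R n) (δ : Offsets p) : Prop :=
  δ.at 0 = 0 ∧
  ∀ (pc : ℕ) (c : Instr R (BitVec n)), p[pc]? = some c →
    ∀ a ∈ c.successors pc, ∀ r : Fin R, c.written ≠ some r → δ.at a r = δ.at pc r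

/-- The instruction emitted for a given one, when the offsets are `d` before and `d'` after it. -/
def emit {R n : ℕ} (d d' : Fin R → BitVec n) : Instr R (BitVec n) → Instr R (BitVec n)
  | .addi x y k => .addi x y (k - d y + d' x)
  | .blt x y k L => .blt x y (k - d y + d x) L
  | .b L => .b L

/-- The object code that is compiled from `p` with the offsets `δ`. -/
def compile {R n : ℕ} (p : Code R n) (δ : Offsets p) : Code R n :=
  p.mapIdx fun pc c => emit (δ.at pc) (δ.at (pc + 1)) c

/-- A randomised compilation of `p`. Maximal-entropy chaotic compilation draws it uniformly: each
instruction that writes is varied as freely as the flow of control allows. -/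
abbrev Compilation {R n : ℕ} (p : Code R n) := {δ : Offsets p // Admissible p δ}

/-- The runtime trace that an observer of the compiled code sees. -/
def observedTrace {R n : ℕ} {p : Code R n} (δ : Compilation p) : ℕ → Option (Entry R n) :=
  trace (compile p δ.1)

/-- The probability of the event `E` under the uniform distribution on a finite type. -/
noncomputable def prob {Ω : Type*} (E : Ω → Prop) : ℝ :=
  (Nat.card {ω : Ω // E ω} : ℝ) / (Nat.card Ω : ℝ)

/-- What the programmer intends bit `pt.2` of the word written in step `pt.1` to be: its value
when the code runs without offsets. Bits and steps are numbered from `0`. -/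
def intendedBit {R n : ℕ} (p : Code R n) (pt : ℕ × ℕ) : Bool :=
  (((trace p pt.1).bind Entry.value).getD 0).getLsbD pt.2

/-! ## Altering one constant -/

/-- In straight-line code that starts with register `x` holding `d` more than before, compensate in
the constants of the instructions that read `x`, until `x` is written over. -/
def compensate {R n : ℕ} (x : Fin R) (d : BitVec n) : Code R n → Code R n
  | [] => []
  | .addi z y k :: p =>
      .addi z y (if y = x then k - d else k) :: (if z = x then p else compensate x d p)
  | c :: p => c :: compensate x d p

/-- Add `d` to the constant of the add instruction at address `M`, and compensate in the following
instructions that read its result. -/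
def alter {R n : ℕ} (d : BitVec n) : ℕ → Code R n → Code R n
  | _, [] => []
  | 0, .addi x y k :: p => .addi x y (k + d) :: compensate x d p
  | 0, c :: p => c :: p
  | M + 1, c :: p => c :: alter d M p

/-! ## Observers: polynomial-time probabilistic Turing machines -/

/-- The (finite) input alphabet of an observer. -/
inductive Sym (R : ℕ) where
  | tick
  | sep
  | addi
  | blt
  | b
  | reg (r : Fin R)
  | bit (v : Bool)

def encodeNat (R : ℕ) (a : ℕ) : List (Sym R) := .sep :: a.bits.map .bit

def encodeWord (R : ℕ) {n : ℕ} (w : BitVec n) : List (Sym R) :=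
  (List.range n).map fun i => .bit (w.getLsbD i)

def encodeInstr {R n : ℕ} : Instr R (BitVec n) → List (Sym R)
  | .addi x y k => [.addi, .reg x, .reg y] ++ encodeWord R k
  | .blt x y k L => [.blt, .reg x, .reg y] ++ encodeWord R k ++ encodeNat R L
  | .b L => .b :: encodeNat R L

def encodeEntry {R n : ℕ} (e : Entry R n) : List (Sym R) :=
  encodeNat R e.pc ++ encodeInstr e.instr ++
    match e.value with
    | none => []
    | some v => encodeWord R v

/-- The observer's input: `n` in unary, then the (possibly endless) trace `T`. Cell `j` depends
only on the first `j + 1` lines of `T`, as each line takes up at least one cell. -/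
def inputTape {R n : ℕ} (T : ℕ → Option (Entry R n)) (j : ℕ) : Option (Sym R) :=
  (List.replicate n .tick ++ ((List.range (j + 1)).filterMap T).flatMap encodeEntry)[j]?

inductive Move where
  | left
  | stay
  | right

/-- A Turing machine with a two-way read-only input tape (infinite to the right), a two-way
infinite work tape, and one coin flip available at each step. It halts in the states that have an
answer, a guess of `m` bits. -/
structure Observer (R m : ℕ) where
  Control : Type
  Symbol : Type
  finite_control : Finite Control
  finite_symbol : Finite Symbol
  start : Control
  blank : Symbol
  answer : Control → Option (Fin m → Bool)
  next : Control → Option (Sym R) → Symbol → Bool → Control × Symbol × Move × Move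

namespace Observer

variable {R m : ℕ}

structure Config (f : Observer R m) where
  control : f.Control
  inputHead : ℕ
  workHead : ℤ
  work : ℤ → f.Symbol

/-- The move of the input head; it cannot leave the left end of the tape. -/
def moveInput (j : ℕ) : Move → ℕ
  | .left => j - 1
  | .stay => j
  | .right => j + 1

def moveWork (j : ℤ) : Move → ℤ
  | .left => j - 1
  | .stay => j
  | .right => j + 1

/-- One step with the given input tape and coin; a halted machine stays put. -/
def stepConfig (f : Observer R m) (tape : ℕ → Option (Sym R)) (coin : Bool) (c : f.Config) :
    f.Config :=
  match f.answer c.control with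
  | some _ => c
  | none =>
    match f.next c.control (tape c.inputHead) (c.work c.workHead) coin with
    | (q, s, mi, mw) =>
      ⟨q, moveInput c.inputHead mi, moveWork c.workHead mw, Function.update c.work c.workHead s⟩

/-- The configuration after `t` steps. -/
def configAt (f : Observer R m) (tape : ℕ → Option (Sym R)) (coins : ℕ → Bool) : ℕ → f.Config
  | 0 => ⟨f.start, 0, 0, fun _ => f.blank⟩
  | t + 1 => f.stepConfig tape (coins t) (f.configAt tape coins t)

/-- The answer on the trace `T` after `t` steps, `none` if the machine is still running. -/
def guess (f : Observer R m) {n : ℕ} (T : ℕ → Option (Entry R n)) (t : ℕ) (coins : Fin t → Bool) :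
    Option (Fin m → Bool) :=
  f.answer (f.configAt (inputTape T) (fun i => if h : i < t then coins ⟨i, h⟩ else false) t).control

/-- For all word sizes `n`, all traces and all coin flips, the machine halts within `τ n` steps. -/
def HaltsWithin (f : Observer R m) (τ : Polynomial ℕ) : Prop :=
  ∀ (n : ℕ) (T : ℕ → Option (Entry R n)) (coins : Fin (τ.eval n) → Bool),
    f.guess T (τ.eval n) coins ≠ none

/-- The probability, over the compilation of `p` and the coin flips, that within `t` steps the
observer of the trace of the compiled code guesses right the `j`-th of the chosen bits `pts`. -/
noncomputable def successAt (f : Observer R m) {n : ℕ} (t : ℕ) (p : Code R n)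
    (pts : Fin m → ℕ × ℕ) (j : Fin m) : ℝ :=
  prob fun ω : Compilation p × (Fin t → Bool) =>
    ∃ a, f.guess (observedTrace ω.1) t ω.2 = some a ∧ a j = intendedBit p (pts j)

/-- The same for all the chosen bits at once. -/
noncomputable def success (f : Observer R m) {n : ℕ} (t : ℕ) (p : Code R n)
    (pts : Fin m → ℕ × ℕ) : ℝ :=
  prob fun ω : Compilation p × (Fin t → Bool) =>
    ∃ a, f.guess (observedTrace ω.1) t ω.2 = some a ∧ ∀ j, a j = intendedBit p (pts j)

end Observer

end Chaotic

open Chaotic Filter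

namespace Chaotic

/-! ## Executions -/

section Execution

variable {R n : ℕ}

/-! An altered constant cannot be told from one that the compiler has varied. Altering an addition
and compensating in its readers rewrites each constant as `k - s y + s' x`, where `s` and `s'` are
the shifts of the register contents before and after the instruction. Compilation with offsets has
the same form (`Instr.adjust`), and such adjustments compose additively. So compiling the altered
code with offsets `δ` gives the object code of the original under `δ` plus the shift. The shift
changes only in the register being written, hence translation by it is a bijection between
admissible offsets (`compilationRunEquiv`), and the observed traces are equidistributed. The
intended word, however, gains `2 ^ i`, which flips its bit `i`.

Two things remain. The unrolled code may be followed by loops; since control never returns from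
there, the compilations factor into offsets of the straight-line part and an independent rest
(`compilationAppendEquiv`), which cancels in probabilities. And the altered code must be an
unrolling of one program for all `n`, although just one execution of an instruction, perhaps inside
a loop, is altered. The alteration is therefore run as a finite automaton (`Mode`), and
`alteredProgram` is the product of `P` with it.

A polynomial-time observer sees fewer than `2 ^ n` lines for large `n`, so it guesses alike on both
codes, whose intentions are opposite. -/

theorem stateAt_succ_of_step {p : Code R n} {t : ℕ} {e : Entry R n} {s : State R n}
    (h : step p (stateAt p t) = some (e, s)) : stateAt p (t + 1) = s := by
  simp [stateAt, h]

theorem stateAt_succ_of_step_eq_none {p : Code R n} {t : ℕ}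
    (h : step p (stateAt p t) = none) : stateAt p (t + 1) = stateAt p t := by
  simp [stateAt, h]

theorem executedAdds_succ_of_step {p : Code R n} {t : ℕ} {e : Entry R n} {s : State R n}
    (h : step p (stateAt p t) = some (e, s)) :
    executedAdds p (t + 1) = executedAdds p t ++ [e.instr].filter Instr.isAddi := by
  simp [executedAdds, List.range_succ, trace, h]

theorem executedAdds_succ_of_step_eq_none {p : Code R n} {t : ℕ}
    (h : step p (stateAt p t) = none) : executedAdds p (t + 1) = executedAdds p t := by
  simp [executedAdds, List.range_succ, trace, h]

theorem isAddi_of_mem_executedAdds {p : Code R n} {t : ℕ} {c : Instr R (BitVec n)}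
    (h : c ∈ executedAdds p t) : c.isAddi = true :=
  (List.mem_filter.1 h).2

theorem Instr.exists_eq_addi {K : Type} {c : Instr R K} (h : c.isAddi = true) :
    ∃ x y k, c = .addi x y k := by
  cases c <;> simp_all [Instr.isAddi]

theorem trace_eq_none_iff {p : Code R n} {t : ℕ} :
    trace p t = none ↔ p.length ≤ (stateAt p t).pc := by
  rw [trace, Option.map_eq_none_iff, step]
  rcases h : p[(stateAt p t).pc]? with _ | (_ | _ | _) <;> simp
  · simpa using h
  all_goals
    by_contra hc
    simp [List.getElem?_eq_none (not_lt.1 (by omega : ¬ (stateAt p t).pc < p.length))] at h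

/-- Straight-line code that is followed by other code runs as it does alone. -/
theorem stateAt_append {A : Code R n} (hA : ∀ c ∈ A, c.isAddi = true) (rest : Code R n) {t : ℕ}
    (ht : t ≤ A.length) :
    stateAt (A ++ rest) t = stateAt A t ∧ (stateAt A t).pc = t := by
  induction t with
  | zero => simp [stateAt]
  | succ t ih =>
    obtain ⟨h1, h2⟩ := ih (by omega)
    obtain ⟨x, y, k, hc⟩ := Instr.exists_eq_addi (hA A[t] (List.getElem_mem _))
    have e1 : A[t]? = some (.addi x y k) := by rw [List.getElem?_eq_getElem (by omega), hc]
    have e2 : (A ++ rest)[t]? = some (.addi x y k) := by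
      rw [List.getElem?_append_left (by omega), e1]
    simp [stateAt, step, h1, h2, e1, e2]

theorem trace_append {A : Code R n} (hA : ∀ c ∈ A, c.isAddi = true) (rest : Code R n) {t : ℕ}
    (ht : t < A.length) : trace (A ++ rest) t = trace A t := by
  obtain ⟨h1, h2⟩ := stateAt_append hA rest ht.le
  have e2 : (A ++ rest)[t]? = A[t]? := List.getElem?_append_left ht
  simp [trace, step, h1, h2, e2]

end Execution

/-! ## Adjusting constants -/

theorem ofInt_sub (n : ℕ) (a b : ℤ) :
    BitVec.ofInt n (a - b) = BitVec.ofInt n a - BitVec.ofInt n b := by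
  rw [eq_sub_iff_add_eq, ← BitVec.ofInt_add, sub_add_cancel]

namespace Instr

variable {R : ℕ} {K : Type}

/-- Adjust the constant to the shifts `s` before and `s'` after the instruction of the contents
of the registers. -/
def adjust [Add K] [Sub K] (s s' : Fin R → K) : Instr R K → Instr R K
  | addi x y k => addi x y (k - s y + s' x)
  | blt x y k L => blt x y (k - s y + s x) L
  | b L => b L

theorem emit_eq_adjust {n : ℕ} (s s' : Fin R → BitVec n) (c : Instr R (BitVec n)) :
    emit s s' c = c.adjust s s' := by
  cases c <;> rfl

/-- The intermediate shifts cancel. Altering and compiling are both adjustments, so altering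
followed by compiling is a single compilation with other offsets. -/
theorem adjust_adjust [AddCommGroup K] (s s' u u' : Fin R → K) (c : Instr R K) :
    (c.adjust s s').adjust (u - s) (u' - s') = c.adjust u u' := by
  cases c <;> simp [adjust]
  all_goals abel

theorem isAddi_adjust [Add K] [Sub K] (s s' : Fin R → K) (c : Instr R K) :
    (c.adjust s s').isAddi = c.isAddi := by
  cases c <;> rfl

theorem written_adjust [Add K] [Sub K] (s s' : Fin R → K) (c : Instr R K) :
    (c.adjust s s').written = c.written := by
  cases c <;> rfl

theorem mapConst_ofInt_adjust {n : ℕ} (s s' : Fin R → ℤ) (c : Instr R ℤ) :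
    (c.adjust s s').mapConst (BitVec.ofInt n) =
      (c.mapConst (BitVec.ofInt n)).adjust (fun r => BitVec.ofInt n (s r))
        (fun r => BitVec.ofInt n (s' r)) := by
  cases c <;> simp [adjust, mapConst, ofInt_sub, BitVec.ofInt_add]

end Instr

/-! ## Alteration as a finite-state transduction -/

/-- While one addition is altered and the readers of its result compensate for that, the altered
addition is still to come, some number of additions ahead, or its result is in some register, or
it has been written over. -/
abbrev Mode (R M : ℕ) := Fin (M + 1) ⊕ Option (Fin R)

namespace Mode

variable {R M : ℕ} {K : Type}

/-- How much more than in the unaltered run the registers hold. -/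
def shift [Zero K] (d : K) : Mode R M → Fin R → K
  | .inr (some x), r => if r = x then d else 0
  | _, _ => 0

/-- Only additions advance the automaton. The countdown thus singles out one execution of an
addition, even of one in a loop. -/
def next : Mode R M → Instr R K → Mode R M
  | .inl c, .addi x _ _ =>
    if c.1 = 0 then .inr (some x) else .inl ⟨c.1 - 1, lt_of_le_of_lt (Nat.sub_le _ _) c.2⟩
  | .inr (some x), .addi z _ _ => if z = x then .inr none else .inr (some x)
  | σ, _ => σ

theorem next_of_not_isAddi (σ : Mode R M) {c : Instr R K} (h : c.isAddi = false) :
    σ.next c = σ := by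
  cases c <;> simp_all [Instr.isAddi] <;> rcases σ with _ | _ | _ <;> rfl

theorem next_mapConst {K' : Type} (g : K → K') (σ : Mode R M) (c : Instr R K) :
    σ.next (c.mapConst g) = σ.next c := by
  cases c <;> rcases σ with _ | _ | _ <;> rfl

/-- This is the admissibility condition on offsets: it lets shifts be added to offsets. -/
theorem shift_next [Zero K] (d : K) (σ : Mode R M) (c : Instr R K) {r : Fin R}
    (h : c.written ≠ some r) : (σ.next c).shift d r = σ.shift d r := by
  rcases c with ⟨x, y, k⟩ | _ | _
  · have hx : x ≠ r := by simpa [Instr.written] using h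
    rcases σ with c | _ | z
    · by_cases hc : c.1 = 0 <;> simp [next, shift, hc, hx.symm]
    · rfl
    · by_cases hz : x = z
      · simp [next, shift, hz, (hz ▸ hx).symm]
      · simp [next, hz]
  all_goals rw [next_of_not_isAddi _ rfl]

/-- The instruction `c` as it is altered in mode `σ`. -/
def out [AddCommGroup K] (d : K) (σ : Mode R M) (c : Instr R K) : Instr R K :=
  c.adjust (σ.shift d) ((σ.next c).shift d)

/-- The mode at the start, when the addition to be altered is `M` additions ahead. -/
def start (R M : ℕ) : Mode R M := .inl (Fin.last M)

/-- The mode after passing the instructions `l`. -/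
def after (σ : Mode R M) (l : List (Instr R K)) : Mode R M := l.foldl next σ

/-- The straight-line code `l` as it is altered from mode `σ` on. -/
def run [AddCommGroup K] (d : K) : Mode R M → List (Instr R K) → List (Instr R K)
  | _, [] => []
  | σ, c :: l => out d σ c :: run d (σ.next c) l

theorem run_append [AddCommGroup K] (d : K) (σ : Mode R M) (l l' : List (Instr R K)) :
    run d σ (l ++ l') = run d σ l ++ run d (σ.after l) l' := by
  induction l generalizing σ with
  | nil => rfl
  | cons c l ih => simp [run, ih, after]

theorem length_run [AddCommGroup K] (d : K) (σ : Mode R M) (l : List (Instr R K)) :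
    (run d σ l).length = l.length := by
  induction l generalizing σ with
  | nil => rfl
  | cons c l ih => simp [run, ih]

theorem getElem?_run [AddCommGroup K] (d : K) (σ : Mode R M) (l : List (Instr R K)) (i : ℕ) :
    (run d σ l)[i]? = l[i]?.map (out d (σ.after (l.take i))) := by
  induction l generalizing σ i with
  | nil => simp [run]
  | cons c l ih => cases i <;> simp [run, ih, after]

theorem after_take_succ (σ : Mode R M) {l : List (Instr R K)} {i : ℕ} {c : Instr R K}
    (h : l[i]? = some c) : σ.after (l.take (i + 1)) = (σ.after (l.take i)).next c := by
  simp [after, List.take_add_one, h]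

theorem isAddi_of_mem_run [AddCommGroup K] (d : K) (σ : Mode R M) {l : List (Instr R K)}
    (h : ∀ c ∈ l, c.isAddi = true) : ∀ c ∈ run d σ l, c.isAddi = true := by
  induction l generalizing σ with
  | nil => simp [run]
  | cons c l ih =>
    simp only [run, List.mem_cons, forall_eq_or_imp, out, Instr.isAddi_adjust] at h ⊢
    exact ⟨h.1, ih _ h.2⟩

/-- Passing `i` additions in straight-line code, on the way to the one to be altered. -/
theorem after_take_last {l : List (Instr R K)} (h : ∀ c ∈ l, c.isAddi = true) {i : ℕ}
    (hi : i ≤ M) (hl : i ≤ l.length) :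
    (start R M).after (l.take i) = .inl ⟨M - i, by omega⟩ := by
  induction i with
  | zero => rfl
  | succ i ih =>
    obtain ⟨x, y, k, hc⟩ := Instr.exists_eq_addi (h l[i] (List.getElem_mem _))
    rw [after_take_succ _ (List.getElem?_eq_getElem (by omega)), ih (by omega) (by omega), hc]
    simp [next, show M - i ≠ 0 by omega]
    omega

/-- The alterations of code in the various modes. -/
def alterFrom {n : ℕ} (d : BitVec n) : Mode R M → Code R n → Code R n
  | .inl c => alter d c.1
  | .inr (some x) => compensate x d
  | .inr none => id

/-- On an addition, one unfolding of `alter` or `compensate` is one transition of the automaton. -/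
theorem alterFrom_append {n : ℕ} (d : BitVec n) (σ : Mode R M) {A : Code R n}
    (hA : ∀ c ∈ A, c.isAddi = true) (rest : Code R n) :
    alterFrom d σ (A ++ rest) = run d σ A ++ alterFrom d (σ.after A) rest := by
  induction A generalizing σ with
  | nil => rfl
  | cons c A ih =>
    obtain ⟨x, y, k, rfl⟩ := Instr.exists_eq_addi (hA c (by simp))
    have ih := fun σ => ih σ fun c hc => hA c (by simp [hc])
    have key : alterFrom d σ (.addi x y k :: (A ++ rest)) =
        out d σ (.addi x y k) :: alterFrom d (σ.next (.addi x y k)) (A ++ rest) := by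
      rcases σ with ⟨_ | c, hc⟩ | _ | z
      · simp [alterFrom, alter, out, Instr.adjust, next, shift]
      · simp [alterFrom, alter, out, Instr.adjust, next, shift]
      · simp [alterFrom, out, Instr.adjust, next, shift]
      · by_cases hz : x = z <;> by_cases hy : y = z <;>
          simp [alterFrom, compensate, out, Instr.adjust, next, shift, hz, hy]
    rw [List.cons_append, key, ih]
    simp [run, after]

/-- The clause on empty `rest` serves complete unrollings, which may be shorter than `2 ^ n`. -/
theorem alter_append {n : ℕ} (d : BitVec n) {A : Code R n}
    (hA : ∀ c ∈ A, c.isAddi = true) (rest : Code R n) :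
    ∃ rest', alter d M (A ++ rest) = run d (start R M) A ++ rest' ∧
      (rest = [] → rest' = []) := by
  refine ⟨_, alterFrom_append d (start R M) hA rest, ?_⟩
  rintro rfl
  rcases (start R M).after A with ⟨_ | c, hc⟩ | _ | z <;>
    simp [alterFrom, alter, compensate]

end Mode

/-! ## The altered program -/

section AlteredProgram

variable {R : ℕ} (M : ℕ) (d : ℤ) (P : Program R)

/-- The address in the altered program of the copy of address `pc` of `P` for the mode `σ`. -/
noncomputable def target (σ : Mode R M) (pc : ℕ) : ℕ :=
  if h : pc < P.length then 2 * Fintype.equivFin (Mode R M × Fin P.length) (σ, ⟨pc, h⟩) + 1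
  else 2 * Fintype.card (Mode R M × Fin P.length) + 1

/-- Targets stay in the copy for the same mode, as branches do not change modes. -/
noncomputable def firstInstr (v : Mode R M × Fin P.length) : Instr R ℤ :=
  (v.1.out d P[v.2]).mapTarget (target M P v.1)

noncomputable def secondInstr (v : Mode R M × Fin P.length) : Instr R ℤ :=
  .b (target M P (v.1.next P[v.2]) (v.2 + 1))

/-- The program that runs like `P`, but with `d` added to the constant of the addition that `P`
executes after `M` others. It has a copy of `P` for each mode; each instruction is followed by
a branch to its successor in the copy for the next mode. -/
noncomputable def alteredProgram : Program R :=
  .b (target M P (Mode.start R M) 0) ::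
    (List.finRange (Fintype.card (Mode R M × Fin P.length))).flatMap fun i =>
      [firstInstr M d P ((Fintype.equivFin _).symm i),
        secondInstr M P ((Fintype.equivFin _).symm i)]

theorem getElem?_flatMap_pair {α β : Type*} (f g : α → β) (l : List α) (i : ℕ) :
    (l.flatMap fun a => [f a, g a])[2 * i]? = l[i]?.map f ∧
      (l.flatMap fun a => [f a, g a])[2 * i + 1]? = l[i]?.map g := by
  induction l generalizing i with
  | nil => simp
  | cons a l ih =>
    cases i with
    | zero => simp
    | succ i => simpa [Nat.mul_add] using ih i

/-- Address `0` holds the initial branch and each pair of mode and address takes two places, hence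
`2 * _ + 1` in `target`. -/
theorem getElem?_alteredProgram (σ : Mode R M) {pc : ℕ} (h : pc < P.length) :
    (alteredProgram M d P)[target M P σ pc]? = some (firstInstr M d P (σ, ⟨pc, h⟩)) ∧
      (alteredProgram M d P)[target M P σ pc + 1]? = some (secondInstr M P (σ, ⟨pc, h⟩)) := by
  have key : ∀ v : Mode R M × Fin P.length,
      (List.finRange (Fintype.card (Mode R M × Fin P.length)))[(Fintype.equivFin _ v : ℕ)]? =
        some (Fintype.equivFin _ v) := fun v => by
    rw [List.getElem?_eq_getElem (by rw [List.length_finRange]; exact Fin.isLt _)]; simp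
  simp only [alteredProgram, target, h, dite_true, List.getElem?_cons_succ]
  simp [getElem?_flatMap_pair, key]

theorem getElem?_alteredProgram_of_le (σ : Mode R M) {pc : ℕ} (h : P.length ≤ pc) :
    (alteredProgram M d P)[target M P σ pc]? = none := by
  simp only [alteredProgram, target, not_lt.2 h, dite_false, List.getElem?_cons_succ]
  simp [getElem?_flatMap_pair]

theorem ofInt_shift (n : ℕ) (σ : Mode R M) :
    (fun r => BitVec.ofInt n (σ.shift d r)) = σ.shift (BitVec.ofInt n d) := by
  funext r
  rcases σ with _ | _ | x
  · simp [Mode.shift]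
  · simp [Mode.shift]
  · by_cases h : r = x <;> simp [Mode.shift, h]

theorem mapConst_firstInstr (n : ℕ) (v : Mode R M × Fin P.length) :
    (firstInstr M d P v).mapConst (BitVec.ofInt n) =
      (v.1.out (BitVec.ofInt n d) (P[v.2].mapConst (BitVec.ofInt n))).mapTarget
        (target M P v.1) := by
  have h : ∀ (g : ℕ → ℕ) (c : Instr R ℤ), (c.mapTarget g).mapConst (BitVec.ofInt n) =
      (c.mapConst (BitVec.ofInt n)).mapTarget g := by
    intro g c; cases c <;> rfl
  rw [firstInstr, h, Mode.out, Instr.mapConst_ofInt_adjust, ofInt_shift, ofInt_shift, Mode.out,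
    Mode.next_mapConst]

/-- The altered program simulates `P`. -/
theorem exists_stateAt_alteredProgram (n t : ℕ) :
    ∃ t', executedAdds ((alteredProgram M d P).onPlatform n) t' =
        Mode.run (BitVec.ofInt n d) (Mode.start R M) (executedAdds (P.onPlatform n) t) ∧
      stateAt ((alteredProgram M d P).onPlatform n) t' =
        ⟨target M P ((Mode.start R M).after (executedAdds (P.onPlatform n) t))
            (stateAt (P.onPlatform n) t).pc,
          (stateAt (P.onPlatform n) t).reg +
            ((Mode.start R M).after (executedAdds (P.onPlatform n) t)).shift
              (BitVec.ofInt n d)⟩ := by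
  set q := (alteredProgram M d P).onPlatform n with hq
  set p := P.onPlatform n with hp
  set D := BitVec.ofInt n d with hD
  induction t with
  | zero =>
    have h0 : q[0]? = some (.b (target M P (Mode.start R M) 0)) := by
      simp [hq, Program.onPlatform, alteredProgram, Instr.mapConst]
    have hs : step q (stateAt q 0) = some (⟨0, .b (target M P (Mode.start R M) 0), none⟩,
        ⟨target M P (Mode.start R M) 0, fun _ => 0⟩) := by
      simp [step, stateAt, h0]
    -- The initial branch takes one step, before `P` has taken any.
    refine ⟨1, ?_, ?_⟩
    · rw [executedAdds_succ_of_step hs]; rfl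
    · rw [stateAt_succ_of_step hs]
      simp only [State.mk.injEq]
      refine ⟨rfl, ?_⟩
      funext r
      simp [stateAt, executedAdds, Mode.after, Mode.start, Mode.shift]
  | succ t ih =>
    obtain ⟨t', ihA, ihS⟩ := ih
    set σ := (Mode.start R M).after (executedAdds p t) with hσ
    rcases hst : stateAt p t with ⟨pc, reg⟩
    rw [hst] at ihS
    by_cases hpc : pc < P.length
    swap
    · have hs : step p (stateAt p t) = none := by
        have e : p[pc]? = none := by simpa [hp, Program.onPlatform] using hpc
        simp [step, hst, e]
      exact ⟨t', by rw [executedAdds_succ_of_step_eq_none hs, ihA], by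
        rw [executedAdds_succ_of_step_eq_none hs, stateAt_succ_of_step_eq_none hs, hst, ihS]⟩
    have ep : p[pc]? = some (P[pc].mapConst (BitVec.ofInt n)) := by
      simp [hp, Program.onPlatform, hpc]
    obtain ⟨q1, q2⟩ := getElem?_alteredProgram M d P σ hpc
    have eq1 : q[target M P σ pc]? = some ((σ.out D (P[pc].mapConst (BitVec.ofInt n))).mapTarget
        (target M P σ)) := by
      simp only [hq, Program.onPlatform, List.getElem?_map, q1, Option.map_some,
        mapConst_firstInstr]
      rfl
    have eq2 : q[target M P σ pc + 1]? = some (.b (target M P (σ.next P[pc]) (pc + 1))) := by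
      simp only [hq, Program.onPlatform, List.getElem?_map, q2, Option.map_some]
      rfl
    rw [← Mode.next_mapConst (BitVec.ofInt n)] at eq2
    generalize P[pc].mapConst (BitVec.ofInt n) = c at ep eq1 eq2
    -- The branch to the successor.
    have second : ∀ t₁ reg', stateAt q t₁ = ⟨target M P σ pc + 1, reg'⟩ →
        executedAdds q (t₁ + 1) = executedAdds q t₁ ∧
          stateAt q (t₁ + 1) = ⟨target M P (σ.next c) (pc + 1), reg'⟩ := by
      intro t₁ reg' h
      have hs : step q (stateAt q t₁) =
          some (⟨target M P σ pc + 1, .b (target M P (σ.next c) (pc + 1)), none⟩,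
            ⟨target M P (σ.next c) (pc + 1), reg'⟩) := by
        simp [step, h, eq2]
      exact ⟨by simp [executedAdds_succ_of_step hs, Instr.isAddi], stateAt_succ_of_step hs⟩
    rcases c with ⟨x, y, k⟩ | ⟨x, y, k, L⟩ | L
    · have hs : step p (stateAt p t) = some (⟨pc, .addi x y k, some (reg y + k)⟩,
          ⟨pc + 1, Function.update reg x (reg y + k)⟩) := by
        simp [step, hst, ep]
      have hs' : step q (stateAt q t') = some (⟨target M P σ pc, σ.out D (.addi x y k),
          some (reg y + k + (σ.next (.addi x y k)).shift D x)⟩,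
          ⟨target M P σ pc + 1, Function.update (reg + σ.shift D) x
            (reg y + k + (σ.next (.addi x y k)).shift D x)⟩) := by
        -- The shift of the source cancels, and the result carries the shift of the next mode.
        have e : reg y + σ.shift D y + (k - σ.shift D y + (σ.next (.addi x y k)).shift D x) =
            reg y + k + (σ.next (.addi x y k)).shift D x := by abel
        simp [step, ihS, eq1, Mode.out, Instr.adjust, Instr.mapTarget, e]
      obtain ⟨a1, a2⟩ := second _ _ (stateAt_succ_of_step hs')
      refine ⟨t' + 1 + 1, ?_, ?_⟩
      · rw [a1, executedAdds_succ_of_step hs', executedAdds_succ_of_step hs, ihA]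
        rw [Mode.run_append, ← hσ]
        rfl
      · rw [a2, executedAdds_succ_of_step hs, stateAt_succ_of_step hs]
        have e : (Mode.start R M).after (executedAdds p t ++
            [Instr.addi x y k].filter Instr.isAddi) = σ.next (.addi x y k) := by
          rw [hσ, Mode.after, Mode.after, List.foldl_append]
          rfl
        simp only [e, State.mk.injEq, true_and]
        funext r
        by_cases hr : r = x
        · simp [hr]
        · simp only [Function.update_of_ne hr, Pi.add_apply]
          rw [Mode.shift_next D σ]
          simpa [Instr.written] using Ne.symm hr
    · have hn : σ.next (.blt x y k L) = σ := Mode.next_of_not_isAddi _ rfl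
      have hs : step p (stateAt p t) = some (⟨pc, .blt x y k L, none⟩,
          ⟨if (reg x - (reg y + k)).msb then L else pc + 1, reg⟩) := by
        simp [step, hst, ep]
      have hs' : step q (stateAt q t') = some (⟨target M P σ pc,
          (σ.out D (.blt x y k L)).mapTarget (target M P σ), none⟩,
          ⟨if (reg x - (reg y + k)).msb then target M P σ L else target M P σ pc + 1,
            reg + σ.shift D⟩) := by
        -- All shifts cancel in the tested difference, so both programs branch alike.
        have e : reg x + σ.shift D x - (reg y + σ.shift D y + (k - σ.shift D y + σ.shift D x)) =
            reg x - (reg y + k) := by abel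
        simp [step, ihS, eq1, Mode.out, Instr.adjust, Instr.mapTarget, e]
      have a0 : executedAdds q (t' + 1) = executedAdds q t' := by
        rw [executedAdds_succ_of_step hs']
        simp [Mode.out, Instr.adjust, Instr.mapTarget, Instr.isAddi]
      have a : executedAdds p (t + 1) = executedAdds p t := by
        rw [executedAdds_succ_of_step hs]
        simp [Instr.isAddi]
      rw [a, stateAt_succ_of_step hs, ← hσ]
      have s' := stateAt_succ_of_step hs'
      -- A branch taken costs one step; falling through costs a second one, for the added branch.
      by_cases hb : (reg x - (reg y + k)).msb
      · exact ⟨t' + 1, by rw [a0, ihA], by simpa [hb] using s'⟩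
      · simp only [hb] at s' ⊢
        obtain ⟨a1, a2⟩ := second _ _ s'
        exact ⟨t' + 1 + 1, by rw [a1, a0, ihA], by rw [a2, hn]; rfl⟩
    · have hs : step p (stateAt p t) = some (⟨pc, .b L, none⟩, ⟨L, reg⟩) := by
        simp [step, hst, ep]
      have hs' : step q (stateAt q t') = some (⟨target M P σ pc, .b (target M P σ L), none⟩,
          ⟨target M P σ L, reg + σ.shift D⟩) := by
        simp [step, ihS, eq1, Mode.out, Instr.adjust, Instr.mapTarget]
      have a : executedAdds p (t + 1) = executedAdds p t := by
        rw [executedAdds_succ_of_step hs]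
        simp [Instr.isAddi]
      refine ⟨t' + 1, ?_, ?_⟩
      · rw [executedAdds_succ_of_step hs', a, ihA]
        simp [Instr.isAddi]
      · rw [a, stateAt_succ_of_step hs, ← hσ, stateAt_succ_of_step hs']

/-- Code to be run after `N` instructions that never passes control back to them. -/
def StaysBeyond {n : ℕ} (N : ℕ) (rest : Code R n) : Prop :=
  ∀ i (c : Instr R (BitVec n)), rest[i]? = some c → ∀ a ∈ c.successors (N + i), N ≤ a

theorem staysBeyond_loopCode {n N base : ℕ} (h : N ≤ base) (pc : ℕ) (p : Code R n) :
    StaysBeyond N (.b (base + (R + 1) * pc) :: loopCode base p) := by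
  intro i c hc a ha
  have hc := List.mem_of_getElem? hc
  rw [List.mem_cons] at hc
  rcases hc with rfl | hc
  · simp only [Instr.successors, List.mem_singleton] at ha
    omega
  · simp only [loopCode, List.mem_flatMap] at hc
    obtain ⟨c', -, hc⟩ := hc
    rcases c' with _ | _ | _ <;>
      simp only [Instr.mapTarget, block, trailers, List.mem_cons, List.mem_append, List.mem_map,
        List.not_mem_nil, or_false] at hc
    · rcases hc with rfl | ⟨_, -, rfl⟩ <;> simp [Instr.successors] at ha <;> omega
    · rcases hc with ⟨_, -, rfl⟩ | rfl <;> simp [Instr.successors] at ha <;> omega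
    · rcases hc with ⟨_, -, rfl⟩ | rfl <;> simp [Instr.successors] at ha <;> omega

/-- `q` is `p` with the addition at address `M` altered, as far as the first `2 ^ n`
instructions go; in both, these are straight-line code to which control never returns. -/
def IsAlteration {n : ℕ} (D : BitVec n) (p q : Code R n) : Prop :=
  ∃ A rest rest' : Code R n, (∀ c ∈ A, c.isAddi = true) ∧
    p = A ++ rest ∧ q = Mode.run D (Mode.start R M) A ++ rest' ∧
    StaysBeyond A.length rest ∧ StaysBeyond A.length rest' ∧
    (2 ^ n ≤ A.length ∨ rest = [] ∧ rest' = [])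

/-- Unroll the altered program up to the step `t'` that the simulation assigns to `t`. Equally many
additions have been executed there, and it has ended if `P` has. -/
theorem exists_isAlteration {n : ℕ} {p : Code R n} (hp : IsUnrolling n P p) :
    ∃ q : Code R n, IsUnrolling n (alteredProgram M d P) q ∧
      IsAlteration M (BitVec.ofInt n d) p q := by
  obtain ⟨t, ht⟩ := hp
  obtain ⟨t', hA, hS⟩ := exists_stateAt_alteredProgram M d P n t
  have hadd : ∀ c ∈ executedAdds (P.onPlatform n) t, c.isAddi = true :=
    fun c => isAddi_of_mem_executedAdds
  rcases ht with ⟨h, rfl⟩ | ⟨h, base, hbase, rfl⟩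
  · refine ⟨_, ⟨t', .inl ⟨?_, rfl⟩⟩, _, [], [], hadd, by simp, by simp [hA],
      by simp [StaysBeyond], by simp [StaysBeyond], .inr ⟨rfl, rfl⟩⟩
    have hpc : P.length ≤ (stateAt (P.onPlatform n) t).pc := by
      simpa [Program.onPlatform] using trace_eq_none_iff.1 h
    rw [trace_eq_none_iff, hS]
    simpa [Program.onPlatform] using getElem?_alteredProgram_of_le M d P
      ((Mode.start R M).after (executedAdds (P.onPlatform n) t)) hpc
  · have hl : (executedAdds ((alteredProgram M d P).onPlatform n) t').length =
        (executedAdds (P.onPlatform n) t).length := by rw [hA, Mode.length_run]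
    refine ⟨_, ⟨t', .inr ⟨hl ▸ h, base, hl ▸ hbase, rfl⟩⟩, _, _, _, hadd, rfl, by rw [hA],
      staysBeyond_loopCode (by omega) _ _, staysBeyond_loopCode (by omega) _ _, .inl h⟩

end AlteredProgram

/-! ## Offsets of straight-line code followed by other code -/

section Compilations

variable {R n : ℕ}

theorem Offsets.at_add {p : Code R n} (δ δ' : Offsets p) (a : ℕ) :
    Offsets.at (δ + δ') a = δ.at a + δ'.at a := rfl

theorem Offsets.at_sub {p : Code R n} (δ δ' : Offsets p) (a : ℕ) :
    Offsets.at (δ - δ') a = δ.at a - δ'.at a := rfl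

/-- Offsets prescribed for all addresses. -/
def Offsets.ofFun (p : Code R n) (g : ℕ → Fin R → BitVec n) : Offsets p := fun i => g i

theorem Offsets.at_ofFun (p : Code R n) (g : ℕ → Fin R → BitVec n) (a : ℕ) :
    (Offsets.ofFun p g).at a = g (min a p.length) := rfl

theorem Offsets.at_fin {p : Code R n} (δ : Offsets p) (i : Fin (p.length + 1)) :
    δ.at i = δ i := by
  rw [Offsets.at]
  congr 1
  ext
  simp
  omega

theorem Offsets.at_min {p : Code R n} (δ : Offsets p) {a b : ℕ} (h : p.length ≤ b) :
    δ.at (min a b) = δ.at a := by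
  simp only [Offsets.at]
  congr 2
  omega

/-- Admissibility is a system of homogeneous linear equations, so admissible offsets form a group;
splitting off the late offsets relies on this. -/
theorem Admissible.add {p : Code R n} {δ δ' : Offsets p} (h : Admissible p δ)
    (h' : Admissible p δ') : Admissible p (δ + δ') := by
  refine ⟨by rw [Offsets.at_add, h.1, h'.1, add_zero], fun pc c hc a ha r hr => ?_⟩
  simp only [Offsets.at_add, Pi.add_apply, h.2 pc c hc a ha r hr, h'.2 pc c hc a ha r hr]

theorem Admissible.sub {p : Code R n} {δ δ' : Offsets p} (h : Admissible p δ)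
    (h' : Admissible p δ') : Admissible p (δ - δ') := by
  refine ⟨by rw [Offsets.at_sub, h.1, h'.1, sub_zero], fun pc c hc a ha r hr => ?_⟩
  simp only [Offsets.at_sub, Pi.sub_apply, h.2 pc c hc a ha r hr, h'.2 pc c hc a ha r hr]

theorem admissible_zero (p : Code R n) : Admissible p 0 := ⟨rfl, fun _ _ _ _ _ _ _ => rfl⟩

instance (p : Code R n) : Nonempty (Compilation p) := ⟨⟨0, admissible_zero p⟩⟩

instance (p : Code R n) : Finite (Compilation p) :=
  have : Finite (BitVec n) := Finite.of_injective BitVec.toFin fun _ _ => BitVec.eq_of_toFin_eq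
  inferInstance

theorem admissible_iff_of_isAddi {A : Code R n} (hA : ∀ c ∈ A, c.isAddi = true)
    (δ : Offsets A) : Admissible A δ ↔ δ.at 0 = 0 ∧ ∀ a c, A[a]? = some c →
      ∀ r, c.written ≠ some r → δ.at (a + 1) r = δ.at a r := by
  refine and_congr_right fun _ => forall_congr' fun a => forall_congr' fun c =>
    imp_congr_right fun hc => ?_
  obtain ⟨x, y, k, rfl⟩ := Instr.exists_eq_addi (hA c (List.mem_of_getElem? hc))
  simp [Instr.successors]

variable {A rest : Code R n}

/-- The offsets in the initial part `A` of the code. -/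
def restrict (hA : ∀ c ∈ A, c.isAddi = true) (δ : Compilation (A ++ rest)) : Compilation A :=
  ⟨.ofFun _ δ.1.at, (admissible_iff_of_isAddi hA _).2 ⟨by
    rw [Offsets.at_ofFun, Nat.zero_min, δ.2.1], fun a c hc r hr => by
    have ha : a < A.length := (List.getElem?_eq_some_iff.1 hc).1
    obtain ⟨x, y, k, rfl⟩ := Instr.exists_eq_addi (hA c (List.mem_of_getElem? hc))
    rw [Offsets.at_ofFun, Offsets.at_ofFun, min_eq_left (by omega), min_eq_left ha.le]
    refine δ.2.2 a _ ?_ (a + 1) (by simp [Instr.successors]) r hr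
    rw [List.getElem?_append_left ha, hc]⟩⟩

/-- Offsets that stay as they are after the initial part `A` of the code. -/
def extend (hr : StaysBeyond A.length rest)
    (δ : Compilation A) : Compilation (A ++ rest) :=
  ⟨.ofFun _ δ.1.at, by
    have e : ∀ a, (Offsets.ofFun (A ++ rest) δ.1.at).at a = δ.1.at a := fun a => by
      rw [Offsets.at_ofFun, Offsets.at_min _ (by simp)]
    refine ⟨by rw [e, δ.2.1], fun pc c hc a ha r hw => ?_⟩
    rw [e, e]
    rcases lt_or_ge pc A.length with h | h
    · rw [List.getElem?_append_left h] at hc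
      exact δ.2.2 pc c hc a ha r hw
    · rw [List.getElem?_append_right h] at hc
      -- The extended offsets are constant from `A.length` on, and control stays there.
      have h' := hr _ c hc a (by rwa [Nat.add_sub_cancel' h])
      rw [← Offsets.at_min _ le_rfl, min_eq_right h', ← Offsets.at_min (a := pc) _ le_rfl,
        min_eq_right h]⟩

theorem at_restrict (hA : ∀ c ∈ A, c.isAddi = true) (δ : Compilation (A ++ rest)) {a : ℕ}
    (h : a ≤ A.length) : (restrict hA δ).1.at a = δ.1.at a := by
  rw [restrict, Offsets.at_ofFun, min_eq_left h]

theorem at_extend (hr : StaysBeyond A.length rest)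
    (δ : Compilation A) (a : ℕ) : (extend hr δ).1.at a = δ.1.at a := by
  rw [extend, Offsets.at_ofFun, Offsets.at_min _ (by simp)]

theorem Compilation.ext_at {p : Code R n} {δ δ' : Compilation p}
    (h : ∀ a ≤ p.length, δ.1.at a = δ'.1.at a) : δ = δ' := by
  refine Subtype.ext (funext fun i => ?_)
  rw [← Offsets.at_fin δ.1, ← Offsets.at_fin δ'.1, h _ (Nat.lt_succ_iff.1 i.2)]

/-- Offsets that vanish in the initial part `A` of the code. -/
abbrev LateOffsets (A rest : Code R n) :=
  {δ : Compilation (A ++ rest) // ∀ a ≤ A.length, δ.1.at a = 0}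

instance : Nonempty (LateOffsets A rest) := ⟨⟨⟨0, admissible_zero _⟩, fun _ _ => rfl⟩⟩

/-- The offsets in the initial part of the code are independent of changes after it. -/
def compilationAppendEquiv (hA : ∀ c ∈ A, c.isAddi = true) (hr : StaysBeyond A.length rest) :
    Compilation (A ++ rest) ≃ Compilation A × LateOffsets A rest where
  toFun δ := (restrict hA δ,
    ⟨⟨δ.1 - (extend hr (restrict hA δ)).1, δ.2.sub (extend hr (restrict hA δ)).2⟩,
      fun a ha => by rw [Offsets.at_sub, at_extend, at_restrict hA δ ha, sub_self]⟩)
  invFun ω := ⟨(extend hr ω.1).1 + ω.2.1.1, (extend hr ω.1).2.add ω.2.1.2⟩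
  left_inv δ := Subtype.ext (add_sub_cancel _ _)
  right_inv ω := by
    obtain ⟨α, κ, hκ⟩ := ω
    have e : restrict hA ⟨(extend hr α).1 + κ.1, (extend hr α).2.add κ.2⟩ = α :=
      Compilation.ext_at fun a ha => by
        rw [at_restrict hA _ ha, Offsets.at_add, at_extend, hκ a ha, add_zero]
    refine Prod.ext e (Subtype.ext (Subtype.ext ?_))
    simp only [e, add_sub_cancel_left]

theorem length_compile (p : Code R n) (δ : Offsets p) : (compile p δ).length = p.length := by
  simp [compile]

theorem isAddi_of_mem_compile (hA : ∀ c ∈ A, c.isAddi = true) (δ : Offsets A) :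
    ∀ c ∈ compile A δ, c.isAddi = true := by
  intro c hc
  obtain ⟨i, hi, rfl⟩ := List.mem_mapIdx.1 hc
  rw [Instr.emit_eq_adjust, Instr.isAddi_adjust]
  exact hA _ (List.getElem_mem _)

theorem compile_append (hA : ∀ c ∈ A, c.isAddi = true) (δ : Compilation (A ++ rest)) :
    ∃ rest', compile (A ++ rest) δ.1 = compile A (restrict hA δ).1 ++ rest' ∧
      (rest = [] → rest' = []) := by
  refine ⟨rest.mapIdx fun i c => emit (δ.1.at (i + A.length)) (δ.1.at (i + A.length + 1)) c, ?_,
    by rintro rfl; rfl⟩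
  rw [compile, List.mapIdx_append]
  congr 1
  refine List.ext_getElem (by simp [compile]) fun i h _ => ?_
  have hi : i < A.length := by simpa using h
  simp only [compile, List.getElem_mapIdx]
  rw [at_restrict hA δ hi.le, at_restrict hA δ hi]

theorem observedTrace_eq_restrict (hA : ∀ c ∈ A, c.isAddi = true)
    (δ : Compilation (A ++ rest)) {i : ℕ} (h : i < A.length ∨ rest = []) :
    observedTrace δ i = observedTrace (restrict hA δ) i := by
  obtain ⟨rest', h1, h2⟩ := compile_append hA δ
  rw [observedTrace, observedTrace, h1]
  rcases h with h | h
  · exact trace_append (isAddi_of_mem_compile hA _) _ (by rwa [length_compile])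
  · rw [h2 h, List.append_nil]

end Compilations

/-! ## Straight-line code with one constant altered -/

section Alteration

variable {R n M : ℕ} (D : BitVec n) {A : Code R n}

/-- The shift just before the instruction at address `a` of `A` in the altered run. -/
def shiftAt (M : ℕ) (A : Code R n) (a : ℕ) : Fin R → BitVec n :=
  ((Mode.start R M).after (A.take a)).shift D

/-- This puts altered code into the form of compiled code, with shifts in place of offsets. -/
theorem getElem?_run_start (M : ℕ) (A : Code R n) (i : ℕ) :
    (Mode.run D (Mode.start R M) A)[i]? =
      A[i]?.map (Instr.adjust (shiftAt D M A i) (shiftAt D M A (i + 1))) := by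
  rw [Mode.getElem?_run]
  rcases h : A[i]? with _ | c
  · rfl
  · simp only [Option.map_some, Mode.out, shiftAt, Mode.after_take_succ _ h]

theorem shiftAt_succ (M : ℕ) {a : ℕ} {c : Instr R (BitVec n)} (h : A[a]? = some c) {r : Fin R}
    (hr : c.written ≠ some r) : shiftAt D M A (a + 1) r = shiftAt D M A a r := by
  rw [shiftAt, shiftAt, Mode.after_take_succ _ h, Mode.shift_next D _ _ hr]

theorem shiftAt_zero (M : ℕ) (A : Code R n) : shiftAt D M A 0 = 0 := by
  funext r
  simp [shiftAt, Mode.after, Mode.start, Mode.shift]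

theorem shiftAt_min (M : ℕ) (A : Code R n) (a : ℕ) :
    shiftAt D M A (min a A.length) = shiftAt D M A a := by
  rcases le_total a A.length with h | h
  · rw [min_eq_left h]
  · rw [min_eq_right h, shiftAt, shiftAt, List.take_of_length_le h, List.take_length]

/-- Offsets for the altered code and offsets for the code itself that lead to the same object
code. -/
def compilationRunEquiv (M : ℕ) (hA : ∀ c ∈ A, c.isAddi = true) :
    Compilation (Mode.run D (Mode.start R M) A) ≃ Compilation A where
  toFun δ := ⟨.ofFun _ fun a => δ.1.at a + shiftAt D M A a, by
    have hδ := (admissible_iff_of_isAddi (Mode.isAddi_of_mem_run D _ hA) _).1 δ.2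
    have hl := Mode.length_run D (Mode.start R M) A
    refine (admissible_iff_of_isAddi hA _).2 ⟨?_, fun a c hc r hr => ?_⟩
    · rw [Offsets.at_ofFun]
      simp only [Nat.zero_min, hδ.1, shiftAt_zero, add_zero]
    · rw [Offsets.at_ofFun, Offsets.at_ofFun]
      simp only [shiftAt_min, Offsets.at_min _ hl.le, Pi.add_apply]
      rw [shiftAt_succ D M hc hr, hδ.2 a _ (by rw [getElem?_run_start, hc]; rfl) r
        (by rwa [Instr.written_adjust])]⟩
  invFun δ := ⟨.ofFun _ fun a => δ.1.at a - shiftAt D M A a, by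
    have hδ := (admissible_iff_of_isAddi hA _).1 δ.2
    have hl := Mode.length_run D (Mode.start R M) A
    refine (admissible_iff_of_isAddi (Mode.isAddi_of_mem_run D _ hA) _).2
      ⟨?_, fun a c hc r hr => ?_⟩
    · rw [Offsets.at_ofFun]
      simp only [Nat.zero_min, hδ.1, shiftAt_zero, sub_zero]
    · rw [getElem?_run_start, Option.map_eq_some_iff] at hc
      obtain ⟨c, hc, rfl⟩ := hc
      rw [Instr.written_adjust] at hr
      rw [Offsets.at_ofFun, Offsets.at_ofFun]
      simp only [hl, shiftAt_min, Offsets.at_min _ le_rfl, Pi.sub_apply]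
      rw [shiftAt_succ D M hc hr, hδ.2 a _ hc r hr]⟩
  left_inv δ := Compilation.ext_at fun a ha => by
    have hl := Mode.length_run D (Mode.start R M) A
    simp only [Offsets.at_ofFun]
    simp only [min_eq_left ha, min_eq_left (hl ▸ ha : a ≤ A.length), add_sub_cancel_right]
  right_inv δ := Compilation.ext_at fun a ha => by
    have hl := Mode.length_run D (Mode.start R M) A
    simp only [Offsets.at_ofFun]
    simp only [min_eq_left ha, min_eq_left (ha.trans hl.ge), sub_add_cancel]

theorem compile_compilationRunEquiv (hA : ∀ c ∈ A, c.isAddi = true)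
    (δ : Compilation (Mode.run D (Mode.start R M) A)) :
    compile A (compilationRunEquiv D M hA δ).1 =
      compile (Mode.run D (Mode.start R M) A) δ.1 := by
  have hl := Mode.length_run D (Mode.start R M) A
  refine List.ext_getElem? fun i => ?_
  have e : ∀ a, (compilationRunEquiv D M hA δ).1.at a = δ.1.at a + shiftAt D M A a := fun a => by
    simp only [compilationRunEquiv, Equiv.coe_fn_mk]
    rw [Offsets.at_ofFun]
    simp only [shiftAt_min, Offsets.at_min _ hl.le]
  simp only [compile, List.getElem?_mapIdx, getElem?_run_start, Option.map_map]
  congr 1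
  funext c
  simp only [Function.comp_apply, Instr.emit_eq_adjust, e]
  rw [← Instr.adjust_adjust (shiftAt D M A i) (shiftAt D M A (i + 1)), add_sub_cancel_right,
    add_sub_cancel_right]

theorem observedTrace_compilationRunEquiv (hA : ∀ c ∈ A, c.isAddi = true)
    (δ : Compilation (Mode.run D (Mode.start R M) A)) :
    observedTrace (compilationRunEquiv D M hA δ) = observedTrace δ := by
  rw [observedTrace, observedTrace, compile_compilationRunEquiv]

theorem stateAt_run (hA : ∀ c ∈ A, c.isAddi = true) {t : ℕ} (ht : t ≤ A.length) :
    stateAt (Mode.run D (Mode.start R M) A) t =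
      ⟨t, (stateAt A t).reg + shiftAt D M A t⟩ := by
  induction t with
  | zero => simp [stateAt, shiftAt_zero]
  | succ t ih =>
    have ih := ih (by omega)
    have hpc := (stateAt_append hA [] (t := t) (by omega)).2
    obtain ⟨x, y, k, hc⟩ := Instr.exists_eq_addi (hA A[t] (List.getElem_mem _))
    have e1 : A[t]? = some (.addi x y k) := by rw [List.getElem?_eq_getElem (by omega), hc]
    have e2 := getElem?_run_start D M A t
    rw [e1] at e2
    simp only [stateAt, step, ih, hpc, e1, e2, Option.map_some, Instr.adjust, State.mk.injEq,
      true_and]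
    funext r
    by_cases hr : r = x
    · simp only [hr, Function.update_self, Pi.add_apply]
      abel
    · simp only [Function.update_of_ne hr, Pi.add_apply]
      rw [shiftAt_succ D M e1 (by simpa [Instr.written] using Ne.symm hr)]

/-- No carry comes from below bit `i`. For `i ≥ n` the summand would vanish. -/
theorem getLsbD_add_two_pow {i : ℕ} (h : i < n) (v : BitVec n) :
    (v + BitVec.ofNat n (2 ^ i)).getLsbD i = !v.getLsbD i := by
  simp only [BitVec.getLsbD, BitVec.toNat_add, BitVec.toNat_ofNat, Nat.testBit_mod_two_pow, h,
    decide_true, Bool.true_and, Nat.add_mod_mod]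
  rw [add_comm, Nat.testBit_two_pow_add_eq]

theorem intendedBit_run {i : ℕ} (hA : ∀ c ∈ A, c.isAddi = true) (hM : M < A.length)
    (hi : i < n) :
    intendedBit (Mode.run (BitVec.ofNat n (2 ^ i)) (Mode.start R M) A) (M, i) =
      !intendedBit A (M, i) := by
  have hpc := (stateAt_append hA [] (t := M) hM.le).2
  obtain ⟨x, y, k, hc⟩ := Instr.exists_eq_addi (hA A[M] (List.getElem_mem _))
  have e1 : A[M]? = some (.addi x y k) := by rw [List.getElem?_eq_getElem hM, hc]
  have e2 := getElem?_run_start (BitVec.ofNat n (2 ^ i)) M A M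
  rw [e1] at e2
  -- After `M` additions the countdown is at `0`, so the addition at address `M` is the altered one.
  have hs : shiftAt (BitVec.ofNat n (2 ^ i)) M A (M + 1) x = BitVec.ofNat n (2 ^ i) := by
    rw [shiftAt, Mode.after_take_succ _ e1, Mode.after_take_last hA le_rfl hM.le]
    simp [Mode.next, Mode.shift]
  simp only [intendedBit, trace, step, stateAt_run _ hA hM.le, hpc, e1, e2, Option.map_some,
    Instr.adjust, Option.bind_some, Option.getD_some, Pi.add_apply, hs]
  rw [← getLsbD_add_two_pow hi]
  congr 1
  abel

theorem intendedBit_append (hA : ∀ c ∈ A, c.isAddi = true) (rest : Code R n) {pt : ℕ × ℕ}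
    (h : pt.1 < A.length) : intendedBit (A ++ rest) pt = intendedBit A pt := by
  rw [intendedBit, intendedBit, trace_append hA rest h]

end Alteration

/-! ## Uniform probability -/

section Prob

/-- An independent factor cancels. Its size is irrelevant, so the loop parts of the two codes may
have different numbers of late offsets. -/
theorem prob_of_equiv {Ω Ω' K : Type*} [Finite K] [Nonempty K] (e : Ω ≃ Ω' × K) {E : Ω → Prop}
    {F : Ω' → Prop} (h : ∀ ω, E ω ↔ F (e ω).1) : prob E = prob F := by
  have h1 : Nat.card {ω // E ω} = Nat.card {ω // F ω} * Nat.card K := by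
    rw [← Nat.card_prod]
    refine Nat.card_congr ((e.subtypeEquiv (q := fun v => F v.1) h).trans ?_)
    exact ⟨fun v => (⟨v.1.1, v.2⟩, v.1.2), fun v => ⟨(v.1.1, v.2), v.1.2⟩, fun _ => rfl,
      fun _ => rfl⟩
  have hK : (Nat.card K : ℝ) ≠ 0 := Nat.cast_ne_zero.2 Nat.card_pos.ne'
  rw [prob, prob, h1, Nat.card_congr e, Nat.card_prod, Nat.cast_mul, Nat.cast_mul,
    mul_div_mul_right _ _ hK]

theorem prob_add_prob_not {Ω : Type*} [Finite Ω] [Nonempty Ω] (E : Ω → Prop) :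
    prob E + prob (fun ω => ¬ E ω) = 1 := by
  classical
  have h : Nat.card {ω // E ω} + Nat.card {ω // ¬ E ω} = Nat.card Ω := by
    rw [← Nat.card_sum]
    exact Nat.card_congr (Equiv.sumCompl E)
  have hΩ : (Nat.card Ω : ℝ) ≠ 0 := Nat.cast_ne_zero.2 Nat.card_pos.ne'
  rw [prob, prob, ← add_div, ← Nat.cast_add, h, div_self hΩ]

theorem prob_mono {Ω : Type*} [Finite Ω] {E F : Ω → Prop} (h : ∀ ω, E ω → F ω) :
    prob E ≤ prob F := by
  rw [prob, prob]
  gcongr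
  exact Nat.card_mono (Set.toFinite {ω | F ω}) h

end Prob

/-! ## Observers read only the beginning of a trace -/

namespace Observer

variable {R m : ℕ}

theorem inputHead_configAt_le (f : Observer R m) (tape : ℕ → Option (Sym R)) (coins : ℕ → Bool)
    (t : ℕ) : (f.configAt tape coins t).inputHead ≤ t := by
  induction t with
  | zero => rfl
  | succ t ih =>
    rw [configAt, stepConfig]
    split
    · omega
    · rcases h : f.next (f.configAt tape coins t).control
        (tape (f.configAt tape coins t).inputHead)
        ((f.configAt tape coins t).work (f.configAt tape coins t).workHead)
        (coins t) with ⟨q, s, _ | _ | _, mw⟩ <;> simp only [moveInput] <;> omega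

theorem configAt_congr (f : Observer R m) {tape tape' : ℕ → Option (Sym R)} (coins : ℕ → Bool)
    {t : ℕ} (h : ∀ j < t, tape j = tape' j) :
    f.configAt tape coins t = f.configAt tape' coins t := by
  induction t with
  | zero => rfl
  | succ t ih =>
    have hh := f.inputHead_configAt_le tape' coins t
    rw [configAt, configAt, ih fun j hj => h j (by omega), stepConfig, stepConfig,
      h _ (by omega)]

/-- The head moves at most one cell per step, so only cells `j < t` are read, and these depend on
the first `t` lines. -/
theorem guess_congr (f : Observer R m) {n : ℕ} {T T' : ℕ → Option (Entry R n)} {t : ℕ}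
    (h : ∀ i < t, T i = T' i) (coins : Fin t → Bool) : f.guess T t coins = f.guess T' t coins := by
  rw [guess, guess, f.configAt_congr _ fun j hj => ?_]
  have e : (List.range (j + 1)).filterMap T = (List.range (j + 1)).filterMap T' :=
    List.filterMap_congr fun i hi => h i (by have := List.mem_range.1 hi; omega)
  rw [inputTape, inputTape, e]

theorem success_le_successAt (f : Observer R m) {n : ℕ} (t : ℕ) (p : Code R n)
    (pts : Fin m → ℕ × ℕ) (j : Fin m) : f.success t p pts ≤ f.successAt t p pts j :=
  prob_mono fun _ ⟨a, h1, h2⟩ => ⟨a, h1, h2 j⟩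

end Observer

/-- The factor `c` is for the induction: a sum is bounded by using `2 * c` for each summand. -/
theorem eventually_mul_eval_le_two_pow (τ : Polynomial ℕ) (c : ℕ) :
    ∀ᶠ n in atTop, c * τ.eval n ≤ 2 ^ n := by
  induction τ using Polynomial.induction_on' generalizing c with
  | add p q hp hq =>
    filter_upwards [hp (2 * c), hq (2 * c)] with n h1 h2
    rw [Polynomial.eval_add]
    linarith
  | monomial k a =>
    have h := (tendsto_pow_const_div_const_pow_of_one_lt k (one_lt_two (α := ℝ))).const_mul
      ((c * a : ℕ) : ℝ)
    rw [mul_zero] at h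
    filter_upwards [h.eventually_le_const one_pos] with n hn
    rw [← mul_div_assoc, div_le_one (by positivity)] at hn
    rw [Polynomial.eval_monomial, ← mul_assoc]
    exact_mod_cast hn

/-! ## Alterations are indistinguishable -/

section Indistinguishable

variable {R n M : ℕ} {p q : Code R n}

/-- Alteration does not change the distribution of the first `2 ^ n` lines of the observed
trace. -/
theorem IsAlteration.prob_congr {D : BitVec n} (h : IsAlteration M D p q) {C : Type}
    {E : (ℕ → Option (Entry R n)) → C → Prop}
    (hE : ∀ T T' c, (∀ i < 2 ^ n, T i = T' i) → (E T c ↔ E T' c)) :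
    prob (fun ω : Compilation q × C => E (observedTrace ω.1) ω.2) =
      prob (fun ω : Compilation p × C => E (observedTrace ω.1) ω.2) := by
  obtain ⟨A, rest, rest', hA, rfl, rfl, hr, hr', hlen⟩ := h
  have hA' := Mode.isAddi_of_mem_run D (Mode.start R M) hA
  have hl := Mode.length_run D (Mode.start R M) A
  rw [← hl] at hr'
  -- Both sides are compared with the compilations of the unaltered straight-line part.
  trans prob (fun ω : Compilation A × C => E (observedTrace ω.1) ω.2)
  · refine prob_of_equiv
      (((((compilationAppendEquiv hA' hr').trans ((compilationRunEquiv D M hA).prodCongr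
        (Equiv.refl _)))).prodCongr (Equiv.refl C)).trans
        ⟨fun v => ((v.1.1, v.2), v.1.2), fun v => ((v.1.1, v.2), v.1.2), fun _ => rfl,
          fun _ => rfl⟩) fun ω => hE _ _ _ fun i hi => ?_
    refine (observedTrace_eq_restrict hA' ω.1 ?_).trans
      (congrFun (observedTrace_compilationRunEquiv D hA (restrict hA' ω.1)).symm i)
    exact hlen.imp (fun h => by omega) And.right
  · refine (prob_of_equiv (((compilationAppendEquiv hA hr).prodCongr (Equiv.refl C)).trans
        ⟨fun v => ((v.1.1, v.2), v.1.2), fun v => ((v.1.1, v.2), v.1.2), fun _ => rfl,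
          fun _ => rfl⟩) fun ω => hE _ _ _ fun i hi => ?_).symm
    exact observedTrace_eq_restrict hA ω.1 (hlen.imp (fun h => by omega) And.left)

theorem IsAlteration.prob_observedTrace {D : BitVec n} (h : IsAlteration M D p q)
    (T : Fin (2 ^ n) → Option (Entry R n)) :
    prob (fun δ : Compilation q => ∀ i : Fin (2 ^ n), observedTrace δ i = T i) =
      prob (fun δ : Compilation p => ∀ i : Fin (2 ^ n), observedTrace δ i = T i) := by
  have e : ∀ r : Code R n,
      prob (fun ω : Compilation r × Unit => ∀ i : Fin (2 ^ n), observedTrace ω.1 i = T i) =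
        prob (fun δ : Compilation r => ∀ i : Fin (2 ^ n), observedTrace δ i = T i) :=
    fun r => prob_of_equiv (Equiv.refl _) fun _ => Iff.rfl
  rw [← e, ← e]
  refine h.prob_congr (E := fun T' _ => ∀ i : Fin (2 ^ n), T' i = T i) fun T₁ T₂ _ h => ?_
  exact forall_congr' fun i => by rw [h i i.2]

theorem IsAlteration.take_eq {D : BitVec n} (h : IsAlteration M D p q) :
    q.take (2 ^ n) = (alter D M p).take (2 ^ n) := by
  obtain ⟨A, rest, rest', hA, rfl, rfl, -, -, hlen⟩ := h
  obtain ⟨rest₁, e, he⟩ := Mode.alter_append (M := M) D hA rest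
  have hl := Mode.length_run D (Mode.start R M) A
  rw [e]
  rcases hlen with hlen | ⟨h1, h2⟩
  · rw [List.take_append_of_le_length (by omega), List.take_append_of_le_length (by omega)]
  · rw [h2, he h1]

theorem IsAlteration.intendedBit_eq {i : ℕ} (h : IsAlteration M (BitVec.ofNat n (2 ^ i)) p q)
    (hi : i < n) (hM : M < p.length) (hM' : M < 2 ^ n) :
    intendedBit q (M, i) = !intendedBit p (M, i) := by
  obtain ⟨A, rest, rest', hA, rfl, rfl, -, -, hlen⟩ := h
  have hMA : M < A.length := by
    rcases hlen with hlen | ⟨rfl, -⟩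
    · omega
    · simpa using hM
  rw [intendedBit_append hA _ hMA, intendedBit_append (Mode.isAddi_of_mem_run _ _ hA) _
    (by rwa [Mode.length_run]), intendedBit_run hA hMA hi]

/-- A guess is right for `q` when it is the opposite of the bit intended in `p`. As the observer
always answers, this is the complement of being right for `p`. -/
theorem IsAlteration.successAt_eq {m : ℕ} {D : BitVec n} (h : IsAlteration M D p q)
    (f : Observer R m) {t : ℕ} (ht : t ≤ 2 ^ n) {pts : Fin m → ℕ × ℕ} {j : Fin m}
    (hb : intendedBit q (pts j) = !intendedBit p (pts j))
    (hf : ∀ (T : ℕ → Option (Entry R n)) (coins : Fin t → Bool), f.guess T t coins ≠ none) :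
    f.successAt t q pts j = 1 - f.successAt t p pts j := by
  rw [eq_sub_iff_add_eq, Observer.successAt, hb, h.prob_congr
    (E := fun T c => ∃ a, f.guess T t c = some a ∧ a j = !intendedBit p (pts j))
    fun T T' c hT => by rw [f.guess_congr fun i hi => hT i (by omega)], add_comm,
    Observer.successAt, ← prob_add_prob_not fun ω : Compilation p × (Fin t → Bool) =>
      ∃ a, f.guess (observedTrace ω.1) t ω.2 = some a ∧ a j = intendedBit p (pts j)]
  congr 2
  funext ω
  obtain ⟨a, ha⟩ := Option.ne_none_iff_exists'.1 (hf (observedTrace ω.1) ω.2)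
  simp [ha, ← Bool.eq_not]

end Indistinguishable

end Chaotic

theorem mainTheorem1 {R m : ℕ} (P : Program R) (Pn : ∀ n, Code R n)
    (hP : ∀ᶠ n in atTop, IsUnrolling n P (Pn n))
    (pts : Fin m → ℕ × ℕ)
    (hpts : ∀ j, ∀ᶠ n in atTop, (pts j).1 < (Pn n).length)
    (j : Fin m) :
    ∃ (Q : Program R) (Qn : ∀ n, Code R n),
      (∀ᶠ n in atTop, IsUnrolling n Q (Qn n)) ∧
      (∀ᶠ n in atTop, (Qn n).take (2 ^ n) =
        (alter (BitVec.ofNat n (2 ^ (pts j).2)) (pts j).1 (Pn n)).take (2 ^ n)) ∧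
      (∀ᶠ n in atTop, ∀ T : Fin (2 ^ n) → Option (Entry R n),
        prob (fun δ : Compilation (Qn n) => ∀ i : Fin (2 ^ n), observedTrace δ i = T i) =
          prob (fun δ : Compilation (Pn n) => ∀ i : Fin (2 ^ n), observedTrace δ i = T i)) ∧
      (∀ᶠ n in atTop, intendedBit (Qn n) (pts j) = !intendedBit (Pn n) (pts j)) ∧
      ∀ (f : Observer R m) (τ : Polynomial ℕ), f.HaltsWithin τ →
        (∀ᶠ n in atTop, f.successAt (τ.eval n) (Qn n) pts j =
          1 - f.successAt (τ.eval n) (Pn n) pts j) ∧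
        ¬ ∃ B : ℝ, 1 / 2 < B ∧ ∃ᶠ n in atTop,
          B ≤ f.success (τ.eval n) (Pn n) pts ∧ B ≤ f.success (τ.eval n) (Qn n) pts := by
  -- The codes are needed for every `n`; where `Pn n` is no unrolling, the empty code serves.
  have hex : ∀ n, ∃ q : Code R n, IsUnrolling n P (Pn n) →
      IsUnrolling n (alteredProgram (pts j).1 (2 ^ (pts j).2) P) q ∧
        IsAlteration (pts j).1 (BitVec.ofNat n (2 ^ (pts j).2)) (Pn n) q := fun n => by
    by_cases h : IsUnrolling n P (Pn n)
    · obtain ⟨q, h1, h2⟩ := exists_isAlteration (pts j).1 (2 ^ (pts j).2) P h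
      refine ⟨q, fun _ => ⟨h1, ?_⟩⟩
      rwa [← BitVec.ofInt_natCast, Nat.cast_pow, Nat.cast_ofNat]
    · exact ⟨[], fun h' => absurd h' h⟩
  choose Qn hQ using hex
  have halt : ∀ᶠ n in atTop,
      IsAlteration (pts j).1 (BitVec.ofNat n (2 ^ (pts j).2)) (Pn n) (Qn n) :=
    hP.mono fun n hn => (hQ n hn).2
  have hbit : ∀ᶠ n in atTop, intendedBit (Qn n) (pts j) = !intendedBit (Pn n) (pts j) := by
    filter_upwards [halt, hpts j, eventually_gt_atTop (pts j).1, eventually_gt_atTop (pts j).2]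
      with n h hl h1 h2
    exact h.intendedBit_eq h2 hl (h1.trans Nat.lt_two_pow_self)
  refine ⟨_, Qn, hP.mono fun n hn => (hQ n hn).1, halt.mono fun n hn => hn.take_eq,
    halt.mono fun n hn => hn.prob_observedTrace, hbit, fun f τ hf => ?_⟩
  have hsucc : ∀ᶠ n in atTop, f.successAt (τ.eval n) (Qn n) pts j =
      1 - f.successAt (τ.eval n) (Pn n) pts j := by
    filter_upwards [halt, hbit, eventually_mul_eval_le_two_pow τ 1] with n h hb ht
    exact h.successAt_eq f (by simpa using ht) hb (hf n)
  refine ⟨hsucc, fun ⟨B, hB, hfreq⟩ => ?_⟩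
  -- For one such `n`, the probabilities of guessing bit `j` right sum to `1`, yet both are at least
  -- `B > 1 / 2`.
  obtain ⟨n, ⟨h1, h2⟩, h3⟩ := (hfreq.and_eventually hsucc).exists
  have h4 := f.success_le_successAt (τ.eval n) (Pn n) pts j
  have h5 := f.success_le_successAt (τ.eval n) (Qn n) pts j
  linarith
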